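/- Let $O\subset\mathbb R^2$ be the regular octagon centred at the origin with unit sides, two of them horizontal, and let $S_O$ be the surface obtained by gluing opposite sides of $O$ by translations. Going clockwise from the top side, the sides are labelled $A,B,C,D,A,B,C,D$, so glued sides carry the same label. A bi-infinite linear trajectory $\tau$ moves in $O$ with constant velocity; when it hits a side it re-enters at the corresponding point of the opposite side, and it never hits a vertex. Its cutting sequence $c(\tau)\in\{A,B,C,D\}^{\mathbb Z}$ is the sequence of labels of the sides it crosses (determined up to the choice of the origin of indices). *Trajectories and sectors.* Let $\Sigma_k=[k\pi/8,(k+1)\pi/8)$ for $0\le k\le 6$ and $\Sigma_7=[7\pi/8,\pi]$. Directions are taken in $[0,\pi]$; a trajectory with another direction is replaced by its image under the rotation by $\pi$, which has the same cutting sequence. The sector of $\tau$ is the $k$ such that the direction of $\tau$ lies in $\Sigma_k$. For $0\le k\le 7$ let $\nu_k$ be the linear isometry of $O$ which maps the directions in $\overline\Sigma_k$ to the directions in $\overline\Sigma_0$: the rotation by $-k\pi/8$ for $k$ even, and the reflection sending the direction $\theta$ to $(k+1)\pi/8-\theta$ for $k$ odd. Let $\Psi_\gamma$ be the affine automorphism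 of $S_O$ with derivative $\gamma=\begin{pmatrix}-1&2(1+\sqrt2)\\0&1\end{pmatrix}$, that is, $\gamma:O\to\gamma O$ followed by cutting $\gamma O$ into pieces and translating them so as to form $O$. Put $\tau_0=\tau$ and $\tau_{k+1}=\Psi_\gamma\,\nu_{s_k}\,\tau_k$, where $s_k=s_k(\tau)$ is the sector of $\tau_k$. Then $\{s_k(\tau)\}_{k\in\mathbb N}$ is the sequence of sectors of $\tau$. *Words.* Let $\pi_0=\mathrm{id}$, $\pi_1=(AD)(BC)$, $\pi_2=(ABCD)$, $\pi_3=(AC)$, $\pi_4=(AC)(BD)$, $\pi_5=(AB)(CD)$, $\pi_6=(ADCB)$, $\pi_7=(BD)$ be the permutations of the labels induced by $\nu_0,\dots,\nu_7$. The diagram $\mathscr D_0$ has the arrows $A\rightleftarrows D\rightleftarrows B\rightleftarrows C$ and $C\to C$, and $\mathscr D_i$ is the diagram which $\pi_i$ carries to $\mathscr D_0$. A word $w\in\{A,B,C,D\}^{\mathbb Z}$ is admissible in diagram $i$ if it describes a path on $\mathscr D_i$, and admissible if this holds for some $i$. A letter of $w$ is $L'$-sandwiched if it is both preceded and followed by $L'$,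 and sandwiched if this holds for some $L'$. The derived word $w'$ is obtained from $w$ by keeping exactly the sandwiched letters; below it is part of each assertion that $w'$ is again bi-infinite. The word $w$ is derivable if $w$ and $w'$ are admissible, and infinitely derivable if $w$ and all its iterated derived words are derivable. Consider the groups of sandwiched letters - $G_0=\{D\text{-sandwiched }A,\ C\text{-sandwiched }B,\ B\text{-sandwiched }C,\ A\text{-sandwiched }D\}$, - $G_1=\{D\text{-sandwiched }A,\ C\text{-sandwiched }B,\ B\text{-sandwiched }C,\ B\text{-sandwiched }D\}$, - $G_2=\{D\text{-sandwiched }A,\ C\text{-sandwiched }B,\ C\text{-sandwiched }C,\ B\text{-sandwiched }D\}$, - $G_3=\{D\text{-sandwiched }A,\ D\text{-sandwiched }B,\ C\text{-sandwiched }C,\ B\text{-sandwiched }D\}$. A derivable word $w$ is coherent with respect to $(i,j)$, $i,j\in\{0,\dots,7\}$, if $w$ is admissible in diagram $i$, all sandwiched letters which occur in $\pi_i\cdot w$ belong to one group $G_k$, the derived word $(\pi_i\cdot w)'$ is admissible in diagram $j$, $j\ne0$, and $k=[j/2]$ (integer part). A word $w$ is infinitely coherent with respect to a sequence $s=\{s_k\}_{k\in\mathbb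 N}$ in $\{0,\dots,7\}$ if $s_k\neq0$ for all $k\ge1$, $w$ is infinitely derivable, and, with $w_0=w$ and $w_{k+1}=(\pi_{s_k}\cdot w_k)'$, the word $w_k$ is coherent with respect to $(s_k,s_{k+1})$ for every $k\in\mathbb N$. **Proposition.** The cutting sequence $c(\tau)$ of every bi-infinite linear trajectory $\tau$ on $S_O$ is infinitely coherent with respect to its sequence of sectors $\{s_k(\tau)\}_{k\in\mathbb N}$. In particular, for every $k$, the sandwiched letters of $\pi_{s_k}\cdot w_k$ fall into the group $G_{[j/2]}$, where $j=s_{k+1}(\tau)$. -/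

import Mathlib

namespace Octagon

/-- The alphabet of labels of the four pairs of opposite sides. -/
inductive Letter where
  | A | B | C | D
  deriving DecidableEq

/-- Bi-infinite words. -/
abbrev Word := ℤ → Letter

/-- The map of the alphabet sending `A, B, C, D` to `a, b, c, d` respectively. -/
def letterMap (a b c d : Letter) : Letter → Letter
  | .A => a
  | .B => b
  | .C => c
  | .D => d

/-! ### Combinatorics of words -/

section Words

open Letter

/-- The permutations `π₀ = id`, `π₁ = (AD)(BC)`, `π₂ = (ABCD)`, `π₃ = (AC)`, `π₄ = (AC)(BD)`,
`π₅ = (AB)(CD)`, `π₆ = (ADCB)`, `π₇ = (BD)`, each written as the list of images of `A, B, C, D`. -/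
def relabel : Fin 8 → Letter → Letter :=
  ![letterMap A B C D, letterMap D C B A, letterMap B C D A, letterMap C B A D,
    letterMap C D A B, letterMap B A D C, letterMap D A B C, letterMap A D C B]

/-- The word `π_i · w`. -/
def act (i : Fin 8) (w : Word) : Word := fun n => relabel i (w n)

/-- The arrows `A ⇄ D ⇄ B ⇄ C` and `C → C` of the transition diagram of the sector `0`. -/
def diagramZero : Set (Letter × Letter) :=
  {(A, D), (D, A), (D, B), (B, D), (B, C), (C, B), (C, C)}

/-- The arrows of the `i`-th transition diagram: it is the diagram which the relabelling `π_i` of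
its vertices carries to the diagram of the sector `0`. -/
def diagram (i : Fin 8) : Set (Letter × Letter) :=
  {x | (relabel i x.1, relabel i x.2) ∈ diagramZero}

/-- `w` describes a bi-infinite path on the `i`-th diagram. -/
def AdmissibleIn (i : Fin 8) (w : Word) : Prop := ∀ n : ℤ, (w n, w (n + 1)) ∈ diagram i

def Admissible (w : Word) : Prop := ∃ i : Fin 8, AdmissibleIn i w

/-- The letter at position `n` is preceded and followed by the letter `L`. -/
def IsSandwichedBy (w : Word) (n : ℤ) (L : Letter) : Prop := w (n - 1) = L ∧ w (n + 1) = L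

def IsSandwiched (w : Word) (n : ℤ) : Prop := ∃ L, IsSandwichedBy w n L

/-- `u` is the derived word `w'`: the bi-infinite word obtained from `w` by keeping exactly the
sandwiched letters, in their order (`φ` lists the positions of the sandwiched letters of `w` in
increasing order; a bi-infinite word is determined up to the choice of the origin). -/
def IsDerived (w u : Word) : Prop :=
  ∃ φ : ℤ → ℤ, StrictMono φ ∧ Set.range φ = {n | IsSandwiched w n} ∧ ∀ n, u n = w (φ n)

/-- The derived word is unique up to the choice of the origin. -/
theorem IsDerived.unique {w u u' : Word} (h : IsDerived w u) (h' : IsDerived w u') :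
    ∃ m, ∀ n, u' n = u (n + m) := by
  obtain ⟨f, hf, hr, hu⟩ := h
  obtain ⟨g, hg, hr', hu'⟩ := h'
  have : ∀ n, ∃ k, f k = g n := fun n => by
    have : g n ∈ Set.range f := by rw [hr, ← hr']; exact ⟨n, rfl⟩
    exact this
  choose k hk using this
  have this2 : ∀ n, ∃ j, g j = f n := fun n => by
    have : f n ∈ Set.range g := by rw [hr', ← hr]; exact ⟨n, rfl⟩
    exact this
  choose j hj using this2
  have km : StrictMono k := fun a b hab => hf.lt_iff_lt.1 (by rw [hk, hk]; exact hg hab)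
  have hs : ∀ n, k (n+1) = k n + 1 := by
    intro n
    have h1 := km (lt_add_one n)
    by_contra hne
    have h2 : k n + 1 < k (n+1) := by omega
    have h3 : g n < g (j (k n + 1)) := by rw [hj, ← hk n]; exact hf (by omega)
    have h4 : g (j (k n + 1)) < g (n+1) := by rw [hj, ← hk (n+1)]; exact hf h2
    have := hg.lt_iff_lt.1 h3; have := hg.lt_iff_lt.1 h4
    omega
  have ht : ∀ n, k n = n + k 0 := by
    intro n
    induction n using Int.induction_on with
    | zero => simp
    | succ i ih => rw [hs, ih]; ring
    | pred i ih => have := hs (-i - 1); simp at this; omega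
  exact ⟨k 0, fun n => by rw [hu', hu, ← ht, hk]⟩

def Derivable (w : Word) : Prop := Admissible w ∧ ∃ u, IsDerived w u ∧ Admissible u

/-- `w` and all its iterated derived words are derivable. -/
def InfinitelyDerivable (w : Word) : Prop :=
  ∃ W : ℕ → Word, W 0 = w ∧ (∀ k, IsDerived (W k) (W (k + 1))) ∧ ∀ k, Derivable (W k)

/-- The groups of sandwiched letters: `group k` consists of the pairs `(L, L')` such that
"`L'`-sandwiched `L`" belongs to the group `G_k`. -/
def group : Fin 4 → Set (Letter × Letter) :=
  ![{(A, D), (B, C), (C, B), (D, A)},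
    {(A, D), (B, C), (C, B), (D, B)},
    {(A, D), (B, C), (C, C), (D, B)},
    {(A, D), (B, D), (C, C), (D, B)}]

/-- The derivable word `w` is coherent with respect to the pair `(i, j)`. -/
def CoherentWith (w : Word) (i j : Fin 8) : Prop :=
  Derivable w ∧
  AdmissibleIn i w ∧
  ∃ k : Fin 4,
    (∀ (n : ℤ) (L : Letter), IsSandwichedBy (act i w) n L → (act i w n, L) ∈ group k) ∧
    (j ≠ 0 ∧ ∃ u, IsDerived (act i w) u ∧ AdmissibleIn j u) ∧
    (k : ℕ) = (j : ℕ) / 2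

/-- The set `S*` of sequences in `{0, …, 7}` in which `0` can occur only as the first entry. -/
def SStar : Set (ℕ → Fin 8) := {s | ∀ k, s k = 0 → k = 0}

/-- `W` is the sequence of renormalized words of `w` with respect to `s`:
`w₀ = w` and `w_{k+1} = (π_{s_k} · w_k)'`. -/
def IsRenormalizedSequence (w : Word) (s : ℕ → Fin 8) (W : ℕ → Word) : Prop :=
  W 0 = w ∧ ∀ k, IsDerived (act (s k) (W k)) (W (k + 1))

/-- `w` is infinitely coherent with respect to the sequence `s`. -/
def InfinitelyCoherentWith (w : Word) (s : ℕ → Fin 8) : Prop :=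
  s ∈ SStar ∧ InfinitelyDerivable w ∧
  ∃ W : ℕ → Word, IsRenormalizedSequence w s W ∧ ∀ k, CoherentWith (W k) (s k) (s (k + 1))

end Words

/-! ### The octagon, linear trajectories and cutting sequences -/

noncomputable section

open Matrix

/-- The plane, in Cartesian coordinates. -/
abbrev Plane := Fin 2 → ℝ

/-- The inradius `(1 + √2) / 2` of the regular octagon with sides of unit length. -/
def inradius : ℝ := (1 + √2) / 2

/-- The vertices, in clockwise order; the first two are the ends of the horizontal top side. -/
def vertex : Fin 8 → Plane :=
  ![![-1 / 2, inradius], ![1 / 2, inradius], ![inradius, 1 / 2], ![inradius, -1 / 2],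
    ![1 / 2, -inradius], ![-1 / 2, -inradius], ![-inradius, -1 / 2], ![-inradius, 1 / 2]]

/-- The interior of the octagon `O`: the points whose distance from the center in each of the eight
directions normal to the sides is less than the inradius. -/
def interiorO : Set Plane :=
  {p | |p 0| < inradius ∧ |p 1| < inradius ∧
    |p 0 + p 1| < √2 * inradius ∧ |p 0 - p 1| < √2 * inradius}

/-- The side `m`, without its endpoints. -/
def side (m : Fin 8) : Set Plane := openSegment ℝ (vertex m) (vertex (m + 1))

/-- The sides are labelled `A, B, C, D, A, B, C, D`, clockwise from the top side; opposite sides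
carry the same label. -/
def sideLabel : Fin 8 → Letter := ![.A, .B, .C, .D, .A, .B, .C, .D]

/-- The translation vector which carries the side `m` onto the opposite side `m + 4`. -/
def glue (m : Fin 8) : Plane := vertex (m + 5) - vertex m

/-- A linear trajectory on the surface `S_O` obtained by gluing opposite sides of `O`, given by its
initial point (represented in `O`) and its constant velocity vector. -/
structure Trajectory where
  point : Plane
  velocity : Plane

/-- The trajectory `τ` is bi-infinite (it does not hit vertices) and `w` is its cutting sequence.
The trajectory is a bi-infinite succession of segments in `O`, all in the direction of the velocity:
the `n`-th one starts at `p n`, runs in the interior of `O` and leaves `O` at an interior point of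
the side `e n`, labelled `w n`; it is then continued from the corresponding point of the opposite
side. The initial point lies on the `0`-th segment. -/
def IsCuttingSequence (τ : Trajectory) (w : Word) : Prop :=
  ∃ (p : ℤ → Plane) (l : ℤ → ℝ) (e : ℤ → Fin 8),
    (∀ n, 0 < l n) ∧
    (∀ n, ∀ t ∈ Set.Ioo 0 (l n), p n + t • τ.velocity ∈ interiorO) ∧
    (∀ n, p n + l n • τ.velocity ∈ side (e n)) ∧
    (∀ n, p (n + 1) = p n + l n • τ.velocity + glue (e n)) ∧
    (∀ n, w n = sideLabel (e n)) ∧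
    ∃ t ∈ Set.Icc 0 (l 0), τ.point = p 0 + t • τ.velocity

/-! ### Sectors and renormalization of trajectories -/

/-- The sectors of directions `[k π/8, (k+1) π/8)` for `k ≤ 6` and `[7π/8, π]` for `k = 7`. -/
def sectorSet (k : Fin 8) : Set ℝ :=
  {θ | ((k : ℕ) : ℝ) * Real.pi / 8 ≤ θ ∧
    (θ < (((k : ℕ) : ℝ) + 1) * Real.pi / 8 ∨ (k = 7 ∧ θ = Real.pi))}

/-- The index of the sector which contains the angle `θ ∈ [0, π]`. -/
def sectorIndex (θ : ℝ) : Fin 8 := ⟨min 7 ⌊8 * θ / Real.pi⌋₊, by omega⟩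

theorem mem_sectorSet_iff {θ : ℝ} (h0 : 0 ≤ θ) (h1 : θ ≤ Real.pi) (k : Fin 8) :
    θ ∈ sectorSet k ↔ sectorIndex θ = k := by
  have hp := Real.pi_pos
  have hx : 0 ≤ 8 * θ / Real.pi := by positivity
  have e1 : ((k : ℕ) : ℝ) * Real.pi / 8 ≤ θ ↔ (k : ℕ) ≤ ⌊8 * θ / Real.pi⌋₊ := by
    rw [Nat.le_floor_iff hx, le_div_iff₀ hp]
    constructor <;> intro h <;> linarith
  have e2 : θ < (((k : ℕ) : ℝ) + 1) * Real.pi / 8 ↔ ⌊8 * θ / Real.pi⌋₊ < (k : ℕ) + 1 := by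
    rw [Nat.floor_lt hx, div_lt_iff₀ hp]
    push_cast
    constructor <;> intro h <;> linarith
  have e3 : θ = Real.pi ↔ 8 ≤ ⌊8 * θ / Real.pi⌋₊ := by
    rw [Nat.le_floor_iff hx, le_div_iff₀ hp]
    push_cast
    constructor
    · rintro rfl; exact le_rfl
    · intro h; linarith
  have e4 : ⌊8 * θ / Real.pi⌋₊ ≤ 8 := by
    apply Nat.floor_le_of_le
    rw [div_le_iff₀ hp]
    push_cast
    linarith
  have e5 : k = 7 ↔ (k : ℕ) = 7 := by
    rw [Fin.ext_iff]; rfl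
  have hk := k.isLt
  rw [Fin.ext_iff]
  simp only [sectorSet, sectorIndex, Set.mem_ofPred_eq]
  rw [e1, e2, e3, e5]
  omega

/-- The angle `θ` of the direction of `τ`; it is in `[0, π]` iff the velocity does not point
downwards. -/
def Trajectory.direction (τ : Trajectory) : ℝ := Complex.arg ⟨τ.velocity 0, τ.velocity 1⟩

/-- The sector `s(τ)`. -/
def Trajectory.sector (τ : Trajectory) : Fin 8 := sectorIndex τ.direction

/-- The isometry `ν_i` of the octagon, which maps the closed sector `i` to the closed sector `0`. -/
def nu : Fin 8 → Matrix (Fin 2) (Fin 2) ℝ :=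
  ![!![1, 0; 0, 1], !![1 / √2, 1 / √2; 1 / √2, -1 / √2],
    !![1 / √2, 1 / √2; -1 / √2, 1 / √2], !![0, 1; 1, 0],
    !![0, 1; -1, 0], !![-1 / √2, 1 / √2; 1 / √2, 1 / √2],
    !![-1 / √2, 1 / √2; -1 / √2, -1 / √2], !![-1, 0; 0, 1]]

/-- The derivative of the affine automorphism `Ψ_γ`. -/
def gamma : Matrix (Fin 2) (Fin 2) ℝ := !![-1, 2 * (1 + √2); 0, 1]

/-- The affine automorphism `Ψ_γ` on the part `y > 1/2` of `O`. With `t = y - 1/2`, the horizontal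
leaf through the point consists of a segment of half-width `inradius - t` at height `y` and of
a segment of half-width `1/2 + t` at height `y - (1 + √2/2)`. The point is reflected in the vertical
axis and moved along the leaf by `2 (1 + √2) t` to the right, starting again on the left each time
it crosses a side. -/
def psiGammaTop (p : Plane) : Plane :=
  let t := p 1 - 1 / 2
  let x := -p 0 + 2 * (1 + √2) * t
  let c := 1 + √2 / 2
  if x ≤ inradius - t then ![x, p 1]
  else if x - c ≤ 1 / 2 + t then ![x - c, p 1 - c]
  else ![x - 2 * c, p 1]

/-- The affine automorphism `Ψ_γ` of `S_O` with derivative `γ`, in terms of representatives in `O`: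
the linear map `γ`, followed by cutting the octagon `γ O` into pieces which are translated so as to
form `O`. The part `|y| ≤ 1/2` of `O` is a horizontal cylinder of circumference `1 + √2`; the parts
`y > 1/2` and `y < -1/2` together form the other horizontal cylinder. -/
def psiGamma (p : Plane) : Plane :=
  if 1 / 2 < p 1 then psiGammaTop p
  else if p 1 < -1 / 2 then -psiGammaTop (-p)
  else
    let x := -p 0 + 2 * (1 + √2) * p 1
    ![x - (1 + √2) * ⌊(x + inradius) / (1 + √2)⌋, p 1]

/-- The normal form `n(τ) = ν_i τ`, where `i` is the sector of `τ`. -/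
def Trajectory.normalForm (τ : Trajectory) : Trajectory where
  point := nu τ.sector *ᵥ τ.point
  velocity := nu τ.sector *ᵥ τ.velocity

/-- The derived trajectory `τ' = Ψ_γ τ`, for `τ` with direction in `[0, π/8]`. -/
def Trajectory.derived (τ : Trajectory) : Trajectory where
  point := psiGamma τ.point
  velocity := gamma *ᵥ τ.velocity

/-- Trajectories are considered with direction in `[0, π]`; a trajectory with another direction is
replaced by its image under the rotation by `π`, which preserves the labels of the sides. -/
def Trajectory.upward (τ : Trajectory) : Trajectory :=
  if 0 ≤ τ.velocity 1 then τ else ⟨-τ.point, -τ.velocity⟩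

/-- The renormalized trajectories: `τ₀ = τ` (with direction in `[0, π]`), `τ_{k+1} = n(τ_k)'`. -/
def Trajectory.renormalized (τ : Trajectory) : ℕ → Trajectory
  | 0 => τ.upward
  | k + 1 => (τ.renormalized k).normalForm.derived

/-- The sequence of sectors `s_k(τ) = s(τ_k)`. -/
def Trajectory.sectors (τ : Trajectory) (k : ℕ) : Fin 8 := (τ.renormalized k).sector

end

end Octagon

namespace Octagon

/-! ### The dihedral group of relabellings -/

/-! The sectors depend only on the velocity, so the base point and the action of Ψ_γ on points can
be discarded. Along a segment of direction v the linear form `cross v` is constant, and the word is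
coded by the successive values `h n` of this form, which the gluings translate
(`IsTransversalCoding`). Each ν_i carries codings to codings and relabels them by π_i, so the
direction may be assumed to lie in the closed sector 0. There only four sides can be exits, and
comparing intervals gives admissibility in diagram 0.

The heart is that deriving a coding in direction v gives a coding in direction γv
(`IsExchangeOrbit.exists_derived`). Since det γ = -1, the value on the derived trajectory is κ - h,
where κ depends only on the labels at the two ends of the segment. A letter that is not sandwiched
leaves κ - h unchanged (`derivedShift_eq`); a sandwiched one changes it as the crossing of a
definite side does (`of_isSandwiched`). Such a crossing forces γv to point out of O through that
side, so the sector of γv excludes the letters outside the group (`mem_group`). As γ maps the closed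
sector 0 into the directions [π/8, π], sector 0 does not recur, and the step can be iterated. -/

theorem relabel_injective (i : Fin 8) : Function.Injective (relabel i) := by
  intro x y
  fin_cases i <;> cases x <;> cases y <;> decide

/-- The relabellings form a group, in the form of left division. -/
theorem exists_relabel_comp (i g : Fin 8) : ∃ j, ∀ x, relabel j (relabel g x) = relabel i x := by
  have key : ∀ i g : Fin 8, ∃ j, relabel j (relabel g .A) = relabel i .A ∧
      relabel j (relabel g .B) = relabel i .B ∧ relabel j (relabel g .C) = relabel i .C ∧
      relabel j (relabel g .D) = relabel i .D := by decide
  obtain ⟨j, hA, hB, hC, hD⟩ := key i g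
  exact ⟨j, fun x => by cases x <;> assumption⟩

theorem relabel_zero (x : Letter) : relabel 0 x = x := by
  cases x <;> rfl

theorem act_zero (w : Word) : act 0 w = w := funext fun n => relabel_zero (w n)

theorem isSandwiched_iff {w : Word} {n : ℤ} : IsSandwiched w n ↔ w (n - 1) = w (n + 1) := by
  constructor
  · rintro ⟨L, h, h'⟩
    rw [h, h']
  · intro h
    exact ⟨_, h, rfl⟩

theorem isSandwiched_act {i : Fin 8} {w : Word} {n : ℤ} :
    IsSandwiched (act i w) n ↔ IsSandwiched w n := by
  simp only [isSandwiched_iff, act, (relabel_injective i).eq_iff]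

theorem IsDerived.act {w u : Word} (h : IsDerived w u) (i : Fin 8) :
    IsDerived (act i w) (act i u) := by
  obtain ⟨φ, hφ, hr, hu⟩ := h
  refine ⟨φ, hφ, ?_, fun n => ?_⟩
  · simpa only [isSandwiched_act] using hr
  · simp only [Octagon.act, hu]

theorem admissibleIn_iff {i : Fin 8} {w : Word} : AdmissibleIn i w ↔ AdmissibleIn 0 (act i w) := by
  simp only [AdmissibleIn, diagram, act, Set.mem_ofPred_eq, relabel_zero]

theorem Admissible.act {w : Word} (h : Admissible w) (g : Fin 8) : Admissible (act g w) := by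
  obtain ⟨i, hi⟩ := h
  obtain ⟨j, hj⟩ := exists_relabel_comp i g
  refine ⟨j, ?_⟩
  rw [admissibleIn_iff] at hi ⊢
  convert hi using 1
  exact funext fun n => hj (w n)

/-- If the letters of `w` are renamed before deriving, then some renaming of the result is the
derived word of `w`. -/
theorem IsDerived.exists_of_act {w u : Word} {s : Fin 8} (h : IsDerived (Octagon.act s w) u)
    (g : Fin 8) : ∃ g', IsDerived (Octagon.act g w) (Octagon.act g' u) := by
  obtain ⟨j, hj⟩ := exists_relabel_comp g s
  refine ⟨j, ?_⟩
  convert h.act j using 1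
  exact funext fun n => (hj (w n)).symm

theorem derivable_of_act {w u : Word} {s : Fin 8} (hw : Admissible w)
    (h : IsDerived (act s w) u) (hu : Admissible u) : Derivable w := by
  obtain ⟨g, hg⟩ := h.exists_of_act 0
  rw [act_zero] at hg
  exact ⟨hw, _, hg, hu.act g⟩

/-- Being sandwiched is invariant under relabelling, so the renormalized words and the iterated
derived words differ only by relabellings, which preserve admissibility. -/
theorem infinitelyDerivable_of_renormalized {w : Word} {s : ℕ → Fin 8} {W : ℕ → Word}
    (hW : IsRenormalizedSequence w s W) (ha : ∀ k, Admissible (W k)) : InfinitelyDerivable w := by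
  choose f hf using fun k g => (hW.2 k).exists_of_act g
  -- `g k` is the accumulated relabelling that turns `W k` into the `k`-th derived word of `w`.
  let g : ℕ → Fin 8 := fun k => Nat.rec 0 (fun k g => f k g) k
  have hd : ∀ k, IsDerived (act (g k) (W k)) (act (g (k + 1)) (W (k + 1))) := fun k => hf k (g k)
  refine ⟨fun k => act (g k) (W k), ?_, hd, fun k => ⟨(ha k).act _, _, hd k, (ha _).act _⟩⟩
  exact (act_zero _).trans hW.1

/-! ### Derived words -/

/-- A set of integers which is unbounded in both directions is enumerated in increasing order
by the integers. -/
theorem exists_strictMono_range_eq {S : Set ℤ} (hU : ∀ n, ∃ m ∈ S, n < m)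
    (hL : ∀ n, ∃ m ∈ S, m < n) : ∃ φ : ℤ → ℤ, StrictMono φ ∧ Set.range φ = S := by
  classical
  obtain ⟨m₀, hm₀, -⟩ := hU 0
  have : Nonempty S := ⟨⟨m₀, hm₀⟩⟩
  have : NoMaxOrder S := ⟨fun a => by
    obtain ⟨m, hm, h⟩ := hU a
    exact ⟨⟨m, hm⟩, h⟩⟩
  have : NoMinOrder S := ⟨fun a => by
    obtain ⟨m, hm, h⟩ := hL a
    exact ⟨⟨m, hm⟩, h⟩⟩
  let _ : SuccOrder S := LinearLocallyFiniteOrder.succOrder S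
  let _ : PredOrder S := LinearLocallyFiniteOrder.predOrder S
  let f : S ≃o ℤ := orderIsoIntOfLinearSuccPredArch
  refine ⟨fun n => f.symm n, fun a b h => f.symm.strictMono h, ?_⟩
  ext x
  constructor
  · rintro ⟨n, rfl⟩
    exact (f.symm n).2
  · intro hx
    exact ⟨f ⟨x, hx⟩, by simp⟩

/-- A function on the integers which is constant across the complement of the range of `φ`. -/
theorem eq_of_const_off_range {φ : ℤ → ℤ} (hφ : StrictMono φ) {H : ℤ → ℝ}
    (hH : ∀ n, n ∉ Set.range φ → H (n + 1) = H n) (k : ℤ) :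
    H (φ (k + 1)) = H (φ k + 1) := by
  have key : ∀ d : ℕ, φ k + 1 + d ≤ φ (k + 1) → H (φ k + 1 + d) = H (φ k + 1) := by
    intro d
    induction d with
    | zero => simp
    | succ d ih =>
      intro hd
      push_cast at hd ⊢
      rw [← ih (by omega), ← add_assoc]
      apply hH
      rintro ⟨j, hj⟩
      have h1 : k < j := hφ.lt_iff_lt.1 (by omega)
      have h2 : j < k + 1 := hφ.lt_iff_lt.1 (by omega)
      omega
  have hlt : φ k < φ (k + 1) := hφ (by omega)
  have := key (φ (k + 1) - (φ k + 1)).toNat (by omega)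
  rwa [show φ k + 1 + ((φ (k + 1) - (φ k + 1)).toNat : ℤ) = φ (k + 1) by omega] at this

/-- In a path on the diagram `0`, one of any eight consecutive inner letters is sandwiched. -/
theorem exists_isSandwiched_of_admissibleIn_zero {w : Word} (h : AdmissibleIn 0 w) (n : ℤ) :
    ∃ m, n < m ∧ m < n + 9 ∧ IsSandwiched w m := by
  by_contra! hc
  have hs : ∀ d : ℕ, d < 8 → w (n + d) ≠ w (n + d + 2) := by
    intro d hd he
    refine hc (n + d + 1) (by omega) (by omega) (isSandwiched_iff.2 ?_)
    convert he using 2 <;> ring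
  have ha : ∀ d : ℕ, (w (n + d), w (n + d + 1)) ∈ diagramZero := by
    intro d
    have := h (n + d)
    simpa only [diagram, Set.mem_ofPred_eq, relabel_zero] using this
  -- These six triples follow one another only along A D B C C B D A, after which D is forced and
  -- sandwiches A. Hence at most six can occur in succession, and eight are contradictory.
  have step : ∀ d : ℕ, d < 8 →
      (w (n + d) = .D ∧ w (n + d + 1) = .B ∧ w (n + d + 2) = .C) ∨
      (w (n + d) = .B ∧ w (n + d + 1) = .C ∧ w (n + d + 2) = .C) ∨
      (w (n + d) = .C ∧ w (n + d + 1) = .C ∧ w (n + d + 2) = .B) ∨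
      (w (n + d) = .C ∧ w (n + d + 1) = .B ∧ w (n + d + 2) = .D) ∨
      (w (n + d) = .B ∧ w (n + d + 1) = .D ∧ w (n + d + 2) = .A) ∨
      (w (n + d) = .A ∧ w (n + d + 1) = .D ∧ w (n + d + 2) = .B) := by
    intro d hd
    have h1 := ha d
    have h2 := ha (d + 1)
    have h3 := hs d hd
    push_cast at h2
    rw [← add_assoc, show n + (d : ℤ) + 1 + 1 = n + d + 2 by ring] at h2
    generalize w (n + d) = x at *
    generalize w (n + d + 1) = y at *
    generalize w (n + d + 2) = z at *
    revert h1 h2 h3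
    cases x <;> cases y <;> cases z <;> simp [diagramZero]
  have s0 := step 0 (by norm_num)
  have s1 := step 1 (by norm_num)
  have s2 := step 2 (by norm_num)
  have s3 := step 3 (by norm_num)
  have s4 := step 4 (by norm_num)
  have s5 := step 5 (by norm_num)
  have s6 := step 6 (by norm_num)
  have s7 := step 7 (by norm_num)
  norm_num [add_assoc] at s0 s1 s2 s3 s4 s5 s6 s7
  grind

noncomputable section

open Matrix

/-! ### Transversal codings -/

/-- The cross product of two vectors. The function `cross v` is constant along the lines of
direction `v`. -/
def cross (v p : Plane) : ℝ := v 0 * p 1 - v 1 * p 0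

/-- `w` codes a trajectory in the direction `v`, described by the values `h n` of `cross v` on its
successive segments and the sides `e n` through which they leave the octagon. -/
def IsTransversalCoding (v : Plane) (w : Word) : Prop :=
  ∃ (h : ℤ → ℝ) (e : ℤ → Fin 8), ∀ n,
    cross v (vertex (e n + 1)) < h n ∧ h n < cross v (vertex (e n)) ∧
    h (n + 1) = h n + cross v (glue (e n)) ∧ w n = sideLabel (e n)

theorem vertex_add_four (m : Fin 8) : vertex (m + 4) = -vertex m := by
  fin_cases m <;> ext k <;> fin_cases k <;> simp [vertex] <;> norm_num

theorem cross_neg (v p : Plane) : cross v (-p) = -cross v p := by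
  simp [cross]; ring

theorem neg_cross (v p : Plane) : cross (-v) p = -cross v p := by
  simp [cross]; ring

theorem cross_glue (v : Plane) (m : Fin 8) :
    cross v (glue m) = -cross v (vertex (m + 1)) - cross v (vertex m) := by
  rw [← cross_neg, ← vertex_add_four, show m + 1 + 4 = m + 5 by rw [add_assoc]; rfl]
  simp only [cross, glue, Pi.sub_apply]
  ring

/-- The rotation by π negates both direction and points, so the values of `cross` persist and each
side becomes the opposite one, with the same label. -/
theorem IsTransversalCoding.neg {v : Plane} {w : Word} (hw : IsTransversalCoding v w) :
    IsTransversalCoding (-v) w := by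
  obtain ⟨h, e, H⟩ := hw
  refine ⟨h, fun n => e n + 4, fun n => ?_⟩
  obtain ⟨h1, h2, h3, h4⟩ := H n
  have e1 : ∀ m : Fin 8, sideLabel (m + 4) = sideLabel m := by decide
  rw [cross_glue] at h3 ⊢
  simp only [add_right_comm _ (4 : Fin 8) 1, vertex_add_four, neg_cross, cross_neg, e1, neg_neg]
  exact ⟨h1, h2, by linarith, h4⟩

/-! ### The isometries ν_i acting on codings -/

theorem sqrt_two_mul_self : √2 * √2 = (2 : ℝ) := Real.mul_self_sqrt (by norm_num)

theorem sqrt_two_inv : 1 / √2 = √2 / 2 := by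
  rw [div_eq_div_iff (by positivity) (by norm_num), sqrt_two_mul_self, one_mul]

theorem neg_sqrt_two_inv : -1 / √2 = -(√2 / 2) := by
  rw [neg_div, sqrt_two_inv]

theorem cross_mulVec (M : Matrix (Fin 2) (Fin 2) ℝ) (v p : Plane) :
    cross (M *ᵥ v) (M *ᵥ p) = M.det * cross v p := by
  simp [cross, mulVec, dotProduct, Fin.sum_univ_two, det_fin_two]
  ring

/-- The image of the vertex `m` under `ν_i`. -/
def vertexPerm (i m : Fin 8) : Fin 8 :=
  ![m, 4 - m, m + 1, 3 - m, m + 2, 2 - m, m + 3, 1 - m] i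

def sidePerm (i m : Fin 8) : Fin 8 :=
  ![m, 3 - m, m + 1, 2 - m, m + 2, 1 - m, m + 3, -m] i

theorem nu_eq : nu =
    ![!![1, 0; 0, 1], !![√2 / 2, √2 / 2; √2 / 2, -(√2 / 2)],
      !![√2 / 2, √2 / 2; -(√2 / 2), √2 / 2], !![0, 1; 1, 0],
      !![0, 1; -1, 0], !![-(√2 / 2), √2 / 2; √2 / 2, √2 / 2],
      !![-(√2 / 2), √2 / 2; -(√2 / 2), -(√2 / 2)], !![-1, 0; 0, 1]] := by
  simp only [nu, sqrt_two_inv, neg_sqrt_two_inv]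

theorem nu_mulVec (i : Fin 8) (v : Plane) : nu i *ᵥ v =
    ![![v 0, v 1], ![√2 / 2 * (v 0 + v 1), √2 / 2 * (v 0 - v 1)],
      ![√2 / 2 * (v 0 + v 1), √2 / 2 * (v 1 - v 0)], ![v 1, v 0],
      ![v 1, -v 0], ![√2 / 2 * (v 1 - v 0), √2 / 2 * (v 0 + v 1)],
      ![√2 / 2 * (v 1 - v 0), -(√2 / 2 * (v 0 + v 1))], ![-v 0, v 1]] i := by
  fin_cases i <;> ext k <;> fin_cases k <;>
    simp [nu_eq, mulVec, dotProduct, Fin.sum_univ_two] <;> ring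

theorem nu_mulVec_vertex (i m : Fin 8) : nu i *ᵥ vertex m = vertex (vertexPerm i m) := by
  have h2 := sqrt_two_mul_self
  fin_cases i <;> fin_cases m <;> ext k <;> fin_cases k <;>
    simp [nu_eq, vertex, vertexPerm, mulVec, dotProduct, Fin.sum_univ_two, inradius] <;>
    linarith

/-- A reflection exchanges the first and last vertex of each side. Its determinant -1 also reverses
the inequalities of a coding, and the two reversals cancel. -/
theorem det_nu (i : Fin 8) :
    ((nu i).det = 1 ∧ ∀ m, vertexPerm i m = sidePerm i m ∧
      vertexPerm i (m + 1) = sidePerm i m + 1) ∨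
    ((nu i).det = -1 ∧ ∀ m, vertexPerm i m = sidePerm i m + 1 ∧
      vertexPerm i (m + 1) = sidePerm i m) := by
  have h2 := sqrt_two_mul_self
  fin_cases i
  · exact .inl ⟨by simp [nu_eq], by decide⟩
  · exact .inr ⟨by simp [nu_eq, det_fin_two]; linarith, by decide⟩
  · exact .inl ⟨by simp [nu_eq, det_fin_two]; linarith, by decide⟩
  · exact .inr ⟨by simp [nu_eq, det_fin_two], by decide⟩
  · exact .inl ⟨by simp [nu_eq, det_fin_two], by decide⟩
  · exact .inr ⟨by simp [nu_eq, det_fin_two]; linarith, by decide⟩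
  · exact .inl ⟨by simp [nu_eq, det_fin_two]; linarith, by decide⟩
  · exact .inr ⟨by simp [nu_eq, det_fin_two], by decide⟩

theorem sideLabel_sidePerm (i m : Fin 8) :
    sideLabel (sidePerm i m) = relabel i (sideLabel m) := by
  revert i m
  decide

theorem IsTransversalCoding.act {v : Plane} {w : Word} (hw : IsTransversalCoding v w)
    (i : Fin 8) : IsTransversalCoding (nu i *ᵥ v) (act i w) := by
  obtain ⟨h, e, H⟩ := hw
  refine ⟨fun n => (nu i).det * h n, fun n => sidePerm i (e n), fun n => ?_⟩
  obtain ⟨h1, h2, h3, h4⟩ := H n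
  have hF : ∀ m, cross (nu i *ᵥ v) (vertex (vertexPerm i m)) = (nu i).det * cross v (vertex m) :=
    fun m => by rw [← nu_mulVec_vertex, cross_mulVec]
  have hl : Octagon.act i w n = sideLabel (sidePerm i (e n)) := by
    rw [sideLabel_sidePerm, ← h4]; rfl
  rw [cross_glue] at h3 ⊢
  dsimp only
  rcases det_nu i with ⟨hd, hv⟩ | ⟨hd, hv⟩
  · rw [hl, ← (hv _).2, ← (hv _).1, hF, hF, hd]
    exact ⟨by linarith, by linarith, by linarith, rfl⟩
  · rw [hl, ← (hv _).1, ← (hv _).2, hF, hF, hd]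
    exact ⟨by linarith, by linarith, by linarith, rfl⟩

/-! ### From cutting sequences to codings -/

theorem cross_add (v p q : Plane) : cross v (p + q) = cross v p + cross v q := by
  simp only [cross, Pi.add_apply]; ring

theorem cross_smul (v p : Plane) (c : ℝ) : cross v (c • p) = c * cross v p := by
  simp only [cross, Pi.smul_apply, smul_eq_mul]; ring

theorem cross_self (v : Plane) : cross v v = 0 := by
  simp only [cross]; ring

/-- A line which runs inside the octagon up to an inner point of the side `m` crosses this side
from the inside to the outside. -/
theorem cross_vertex_succ_lt {v q : Plane} {l : ℝ} {m : Fin 8} (hl : 0 < l)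
    (hin : ∀ t ∈ Set.Ioo 0 l, q + t • v ∈ interiorO) (hs : q + l • v ∈ side m) :
    cross v (vertex (m + 1)) < cross v (vertex m) := by
  obtain ⟨a, b, ha, hb, hab, hp⟩ := hs
  -- The point at time `l / 2` is strictly inside the line carrying the side and the point at time
  -- `l` is on it, so v has a positive component along the outward normal. For unit sides this
  -- component is `cross v (vertex m) - cross v (vertex (m + 1))`.
  have h := hin (l / 2) ⟨by linarith, by linarith⟩
  have h0 : q 0 = a * vertex m 0 + b * vertex (m + 1) 0 - l * v 0 := by
    have := congrFun hp 0
    simp at this; linarith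
  have h1 : q 1 = a * vertex m 1 + b * vertex (m + 1) 1 - l * v 1 := by
    have := congrFun hp 1
    simp at this; linarith
  obtain rfl : b = 1 - a := by linarith
  have h2 := sqrt_two_mul_self
  have hr : (0 : ℝ) < √2 := by positivity
  simp only [interiorO, Set.mem_ofPred_eq, Pi.add_apply, Pi.smul_apply, smul_eq_mul, abs_lt, h0, h1]
    at h
  obtain ⟨⟨k1, k2⟩, ⟨k3, k4⟩, ⟨k5, k6⟩, k7, k8⟩ := h
  clear h0 h1 hp hin
  by_contra! hc
  have hc₁ := mul_nonneg hl.le (sub_nonneg.2 hc)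
  clear hc
  have hv : vertex 0 = ![-1 / 2, inradius] ∧ vertex 1 = ![1 / 2, inradius] ∧
    vertex 2 = ![inradius, 1 / 2] ∧ vertex 3 = ![inradius, -1 / 2] ∧
    vertex 4 = ![1 / 2, -inradius] ∧ vertex 5 = ![-1 / 2, -inradius] ∧
    vertex 6 = ![-inradius, -1 / 2] ∧ vertex 7 = ![-inradius, 1 / 2] :=
    ⟨rfl, rfl, rfl, rfl, rfl, rfl, rfl, rfl⟩
  obtain ⟨v0, v1, v2, v3, v4, v5, v6, v7⟩ := hv
  fin_cases m <;>
    simp [cross, v0, v1, v2, v3, v4, v5, v6, v7, inradius] at hc₁ k1 k2 k3 k4 k5 k6 k7 k8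
  · linarith
  · have hS : 0 < l * (v 0 + v 1) := by linarith
    linarith [mul_pos hr hS]
  · linarith
  · have hS : 0 < l * (v 0 - v 1) := by linarith
    linarith [mul_pos hr hS]
  · linarith
  · have hS : 0 < l * (-v 0 - v 1) := by linarith
    linarith [mul_pos hr hS]
  · linarith
  · have hS : 0 < l * (v 1 - v 0) := by linarith
    linarith [mul_pos hr hS]

theorem IsCuttingSequence.isTransversalCoding {τ : Trajectory} {w : Word}
    (h : IsCuttingSequence τ w) : IsTransversalCoding τ.velocity w := by
  obtain ⟨p, l, e, hl, hin, hs, hp, hw, -⟩ := h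
  refine ⟨fun n => cross τ.velocity (p n), e, fun n => ?_⟩
  have hlt := cross_vertex_succ_lt (hl n) (hin n) (hs n)
  obtain ⟨a, b, ha, hb, hab, hq⟩ := hs n
  have hq' := congrArg (cross τ.velocity) hq
  simp only [cross_add, cross_smul, cross_self, mul_zero, add_zero] at hq'
  obtain rfl : b = 1 - a := by linarith
  refine ⟨?_, ?_, ?_, hw n⟩
  · nlinarith
  · nlinarith
  · simp only [hp, cross_add, cross_smul, cross_self, mul_zero, add_zero]

/-! ### The closed sector `0` and the sector index -/

/-- The angle of `v` is in `[0, π/8]`, or `v = 0`. -/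
def InClosedSectorZero (v : Plane) : Prop := 0 ≤ v 1 ∧ (1 + √2) * v 1 ≤ v 0

/-- After multiplication by cos(π/8), this is a consequence of the double-angle formulas at π/4. -/
theorem cos_pi_div_eight_eq : Real.cos (Real.pi / 8) = (1 + √2) * Real.sin (Real.pi / 8) := by
  have hp := Real.pi_pos
  have hc : 0 < Real.cos (Real.pi / 8) :=
    Real.cos_pos_of_mem_Ioo ⟨by linarith, by linarith⟩
  have h1 := Real.sin_two_mul (Real.pi / 8)
  have h2 := Real.cos_two_mul (Real.pi / 8)
  rw [show 2 * (Real.pi / 8) = Real.pi / 4 by ring] at h1 h2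
  rw [Real.sin_pi_div_four] at h1
  rw [Real.cos_pi_div_four] at h2
  apply mul_left_cancel₀ hc.ne'
  linear_combination (-1 / 2 : ℝ) * h2 + (1 + √2) / 2 * h1 - (1 / 4 : ℝ) * sqrt_two_mul_self

/-- This turns the angular bound φ ≤ π/8 into the linear inequality of `InClosedSectorZero`. -/
theorem sin_pi_div_eight_sub (φ : ℝ) : Real.sin (Real.pi / 8 - φ) =
    Real.sin (Real.pi / 8) * (Real.cos φ - (1 + √2) * Real.sin φ) := by
  rw [Real.sin_sub, cos_pi_div_eight_eq]
  ring

theorem sin_pi_div_eight_pos : 0 < Real.sin (Real.pi / 8) :=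
  Real.sin_pos_of_pos_of_lt_pi (by linarith [Real.pi_pos]) (by linarith [Real.pi_pos])

theorem inClosedSectorZero_of_angle {v : Plane} {r φ : ℝ} (hr : 0 ≤ r) (h0 : 0 ≤ φ)
    (h1 : φ ≤ Real.pi / 8) (hx : v 0 = r * Real.cos φ) (hy : v 1 = r * Real.sin φ) :
    InClosedSectorZero v := by
  have hp := Real.pi_pos
  have hs : 0 ≤ Real.sin φ := Real.sin_nonneg_of_nonneg_of_le_pi h0 (by linarith)
  have hd : 0 ≤ Real.sin (Real.pi / 8 - φ) :=
    Real.sin_nonneg_of_nonneg_of_le_pi (by linarith) (by linarith)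
  rw [sin_pi_div_eight_sub] at hd
  have hd' := nonneg_of_mul_nonneg_right hd sin_pi_div_eight_pos
  rw [InClosedSectorZero, hx, hy]
  exact ⟨mul_nonneg hr hs, by nlinarith⟩

/-- Polar coordinates, in terms of the sector. -/
theorem exists_polar (τ : Trajectory) (h : 0 ≤ τ.velocity 1) : ∃ r θ : ℝ, 0 ≤ r ∧
    τ.velocity 0 = r * Real.cos θ ∧ τ.velocity 1 = r * Real.sin θ ∧
    θ ∈ sectorSet τ.sector ∧ (τ.velocity ≠ 0 → 0 < r) := by
  set z : ℂ := ⟨τ.velocity 0, τ.velocity 1⟩ with hz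
  refine ⟨‖z‖, z.arg, norm_nonneg _, ?_, ?_, ?_, ?_⟩
  · rw [Complex.norm_mul_cos_arg]
  · rw [Complex.norm_mul_sin_arg]
  · exact (mem_sectorSet_iff (Complex.arg_nonneg_iff.2 h) (Complex.arg_le_pi z) _).2 rfl
  · intro hv
    rw [norm_pos_iff]
    intro h0
    apply hv
    ext i
    fin_cases i
    · exact congrArg Complex.re h0
    · exact congrArg Complex.im h0

theorem inClosedSectorZero_nu_sector (τ : Trajectory) (h : 0 ≤ τ.velocity 1) :
    InClosedSectorZero (nu τ.sector *ᵥ τ.velocity) := by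
  obtain ⟨r, θ, hr, hx, hy, hθ, -⟩ := exists_polar τ h
  have hp := Real.pi_pos
  have hθ' : ((τ.sector : ℕ) : ℝ) * Real.pi / 8 ≤ θ ∧
      θ ≤ (((τ.sector : ℕ) : ℝ) + 1) * Real.pi / 8 := by
    refine ⟨hθ.1, ?_⟩
    rcases hθ.2 with h | ⟨h, h'⟩
    · exact h.le
    · rw [h, h']; norm_num
  generalize τ.sector = k at *
  clear hθ
  obtain ⟨h1, h2⟩ := hθ'
  -- The witness φ is θ - kπ/8 for even k and (k+1)π/8 - θ for odd k, arranged so that only exact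
  -- values at π/4, π/2 and π enter.
  fin_cases k <;> norm_num at h1 h2
  · exact inClosedSectorZero_of_angle (φ := θ) hr (by linarith) (by linarith)
      (by rw [nu_mulVec]; exact hx) (by rw [nu_mulVec]; exact hy)
  · refine inClosedSectorZero_of_angle (φ := Real.pi / 4 - θ) hr (by linarith) (by linarith) ?_ ?_ <;>
      rw [nu_mulVec]
    · change √2 / 2 * (τ.velocity 0 + τ.velocity 1) = _
      rw [hx, hy, Real.cos_sub, Real.cos_pi_div_four, Real.sin_pi_div_four]; ring
    · change √2 / 2 * (τ.velocity 0 - τ.velocity 1) = _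
      rw [hx, hy, Real.sin_sub, Real.cos_pi_div_four, Real.sin_pi_div_four]; ring
  · refine inClosedSectorZero_of_angle (φ := θ - Real.pi / 4) hr (by linarith) (by linarith) ?_ ?_ <;>
      rw [nu_mulVec]
    · change √2 / 2 * (τ.velocity 0 + τ.velocity 1) = _
      rw [hx, hy, Real.cos_sub, Real.cos_pi_div_four, Real.sin_pi_div_four]; ring
    · change √2 / 2 * (τ.velocity 1 - τ.velocity 0) = _
      rw [hx, hy, Real.sin_sub, Real.cos_pi_div_four, Real.sin_pi_div_four]; ring
  · refine inClosedSectorZero_of_angle (φ := Real.pi / 2 - θ) hr (by linarith) (by linarith) ?_ ?_ <;>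
      rw [nu_mulVec]
    · change τ.velocity 1 = _
      rw [hy, Real.cos_pi_div_two_sub]
    · change τ.velocity 0 = _
      rw [hx, Real.sin_pi_div_two_sub]
  · refine inClosedSectorZero_of_angle (φ := θ - Real.pi / 2) hr (by linarith) (by linarith) ?_ ?_ <;>
      rw [nu_mulVec]
    · change τ.velocity 1 = _
      rw [hy, Real.cos_sub_pi_div_two]
    · change -τ.velocity 0 = _
      rw [hx, Real.sin_sub_pi_div_two]; ring
  · refine inClosedSectorZero_of_angle (φ := Real.pi - (Real.pi / 4 + θ)) hr (by linarith) (by linarith) ?_ ?_ <;>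
      rw [nu_mulVec]
    · change √2 / 2 * (τ.velocity 1 - τ.velocity 0) = _
      rw [hx, hy, Real.cos_pi_sub, Real.cos_add, Real.cos_pi_div_four, Real.sin_pi_div_four]; ring
    · change √2 / 2 * (τ.velocity 0 + τ.velocity 1) = _
      rw [hx, hy, Real.sin_pi_sub, Real.sin_add, Real.cos_pi_div_four, Real.sin_pi_div_four]; ring
  · refine inClosedSectorZero_of_angle (φ := Real.pi / 4 + θ - Real.pi) hr (by linarith) (by linarith) ?_ ?_ <;>
      rw [nu_mulVec]
    · change √2 / 2 * (τ.velocity 1 - τ.velocity 0) = _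
      rw [hx, hy, Real.cos_sub_pi, Real.cos_add, Real.cos_pi_div_four, Real.sin_pi_div_four]; ring
    · change -(√2 / 2 * (τ.velocity 0 + τ.velocity 1)) = _
      rw [hx, hy, Real.sin_sub_pi, Real.sin_add, Real.cos_pi_div_four, Real.sin_pi_div_four]; ring
  · refine inClosedSectorZero_of_angle (φ := Real.pi - θ) hr (by linarith) (by linarith) ?_ ?_ <;>
      rw [nu_mulVec]
    · change -τ.velocity 0 = _
      rw [hx, Real.cos_pi_sub]; ring
    · change τ.velocity 1 = _
      rw [hy, Real.sin_pi_sub]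

/-- Sector 0 is half-open, so the direction π/8, which γ fixes, is already in sector 1. Zero
velocity must be excluded because its argument is 0 by convention. -/
theorem sector_ne_zero {τ : Trajectory} (h : 0 ≤ τ.velocity 1) (hv : τ.velocity ≠ 0)
    (hx : τ.velocity 0 ≤ (1 + √2) * τ.velocity 1) : τ.sector ≠ 0 := by
  obtain ⟨r, θ, -, ex, ey, hθ, hr⟩ := exists_polar τ h
  have hp := Real.pi_pos
  replace hr := hr hv
  intro h0
  rw [h0] at hθ
  obtain ⟨h1, h2 | ⟨h2, -⟩⟩ := hθ
  · norm_num at h1 h2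
    have hd : 0 < Real.sin (Real.pi / 8 - θ) :=
      Real.sin_pos_of_pos_of_lt_pi (by linarith) (by linarith)
    rw [sin_pi_div_eight_sub] at hd
    have hd' := pos_of_mul_pos_right hd sin_pi_div_eight_pos.le
    rw [ex, ey] at hx
    nlinarith
  · exact absurd h2 (by decide)

open Letter

/-! ### Codings in the closed sector `0` -/

theorem cross_vertex (v : Plane) :
    cross v (vertex 0) = (v 0 + √2 * v 0 + v 1) / 2 ∧
    cross v (vertex 1) = (v 0 + √2 * v 0 - v 1) / 2 ∧
    cross v (vertex 2) = (v 0 - v 1 - √2 * v 1) / 2 ∧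
    cross v (vertex 3) = (-v 0 - v 1 - √2 * v 1) / 2 ∧
    cross v (vertex 4) = -(v 0 + √2 * v 0 + v 1) / 2 ∧
    cross v (vertex 5) = -(v 0 + √2 * v 0 - v 1) / 2 ∧
    cross v (vertex 6) = -(v 0 - v 1 - √2 * v 1) / 2 ∧
    cross v (vertex 7) = -(-v 0 - v 1 - √2 * v 1) / 2 := by
  refine ⟨?_, ?_, ?_, ?_, ?_, ?_, ?_, ?_⟩ <;> simp [cross, vertex, inradius] <;> ring

/-- The side with a given label through which trajectories in the sector `0` leave the octagon. -/
def exitSide : Letter → Fin 8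
  | A => 0
  | B => 1
  | C => 2
  | D => 3

/-- The interval exchange which describes the trajectories in the sector `0`. -/
def IsExchangeOrbit (v : Plane) (w : Word) (h : ℤ → ℝ) : Prop :=
  ∀ n, cross v (vertex (exitSide (w n) + 1)) < h n ∧ h n < cross v (vertex (exitSide (w n))) ∧
    h (n + 1) = h n - cross v (vertex (exitSide (w n) + 1)) - cross v (vertex (exitSide (w n)))

/-- Sides 4 to 7 have outward normals against which v has no positive component, so their intervals
of values are empty. -/
theorem IsTransversalCoding.exists_isExchangeOrbit {v : Plane} {w : Word}
    (hw : IsTransversalCoding v w) (hv : InClosedSectorZero v) : ∃ h, IsExchangeOrbit v w h := by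
  obtain ⟨h, e, H⟩ := hw
  refine ⟨h, fun n => ?_⟩
  obtain ⟨h1, h2, h3, h4⟩ := H n
  obtain ⟨c0, c1, c2, c3, c4, c5, c6, c7⟩ := cross_vertex v
  obtain ⟨hy, hx⟩ := hv
  have hr : 0 ≤ √2 * v 1 := by positivity
  -- The sector inequality times √2, with √2 * √2 reduced, makes the remaining inequalities linear
  -- in v 0, v 1, √2 * v 0 and √2 * v 1.
  have hr' : √2 * v 1 + 2 * v 1 ≤ √2 * v 0 := by
    linear_combination √2 * hx - v 1 * sqrt_two_mul_self
  have he : exitSide (w n) = e n := by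
    rw [h4]
    generalize e n = m at *
    clear h3 h4
    fin_cases m <;> first
      | rfl
      | exfalso
        simp only [Fin.reduceFinMk, Fin.reduceAdd, c0, c4, c5, c6, c7] at h1 h2
        linarith
  rw [he]
  rw [cross_glue] at h3
  exact ⟨h1, h2, by linarith⟩

/-- When x → y is not an arrow, the translated interval of x is disjoint from the interval of y. -/
theorem IsExchangeOrbit.admissibleIn_zero {v : Plane} {w : Word} {h : ℤ → ℝ}
    (H : IsExchangeOrbit v w h) (hv : InClosedSectorZero v) : AdmissibleIn 0 w := by
  intro n
  obtain ⟨h1, h2, h3⟩ := H n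
  obtain ⟨h4, h5, -⟩ := H (n + 1)
  obtain ⟨c0, c1, c2, c3, c4, -⟩ := cross_vertex v
  obtain ⟨hy, hx⟩ := hv
  have hr : 0 ≤ √2 * v 1 := by positivity
  have hr' : √2 * v 1 + 2 * v 1 ≤ √2 * v 0 := by
    linear_combination √2 * hx - v 1 * sqrt_two_mul_self
  simp only [diagram, relabel_zero, Set.mem_ofPred_eq]
  generalize w n = x at *
  generalize w (n + 1) = y at *
  rw [h3] at h4 h5
  clear h3
  cases x <;> cases y <;> first
    | (simp [diagramZero]; done)
    | exfalso
      simp only [exitSide, Fin.reduceAdd, c0, c1, c2, c3, c4] at h1 h2 h4 h5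
      linarith

/-! ### The derived coding -/

theorem gamma_mulVec (v : Plane) :
    (gamma *ᵥ v) 0 = -v 0 + 2 * (v 1 + √2 * v 1) ∧ (gamma *ᵥ v) 1 = v 1 := by
  simp [gamma, mulVec, dotProduct, Fin.sum_univ_two]
  ring

/-- The side which the derived trajectory crosses at an `L'`-sandwiched letter `L`. -/
def sandwichSide : Letter → Letter → Fin 8
  | A, _ => 0
  | B, C => 1
  | B, _ => 5
  | C, B => 2
  | C, _ => 6
  | D, A => 3
  | D, _ => 7

/-- The constant `κ` such that `κ - h` is the value of `cross (gamma *ᵥ v)` on the derived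
trajectory, where `h` is the value of `cross v` on a segment between sides with the given labels. -/
def derivedShift (v : Plane) : Letter → Letter → ℝ
  | D, A => 3 * v 1 + 2 * (√2 * v 1)
  | B, D => 2 * v 1 - v 0 + (3 * (√2 * v 1) - √2 * v 0) / 2
  | C, B => v 1 + √2 * v 1
  | B, C => -(v 1 + √2 * v 1)
  | D, B => -(2 * v 1 - v 0 + (3 * (√2 * v 1) - √2 * v 0) / 2)
  | A, D => -(3 * v 1 + 2 * (√2 * v 1))
  | _, _ => 0

/-- Only the triples A D B, D B C, B C C and their reversals occur, and the constants are chosen so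
that their jumps match those of `h`. For C C the default value 0 is the required constant. -/
theorem IsExchangeOrbit.derivedShift_eq {v : Plane} {w : Word} {h : ℤ → ℝ}
    (H : IsExchangeOrbit v w h) (hv : InClosedSectorZero v) {n : ℤ}
    (hn : w (n - 1) ≠ w (n + 1)) :
    derivedShift v (w n) (w (n + 1)) - h (n + 1) = derivedShift v (w (n - 1)) (w n) - h n := by
  obtain ⟨-, -, h3⟩ := H n
  have ha := H.admissibleIn_zero hv (n - 1)
  have hb := H.admissibleIn_zero hv n
  obtain ⟨-, c1, c2, c3, c4, -⟩ := cross_vertex v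
  rw [sub_add_cancel] at ha
  simp only [diagram, relabel_zero, Set.mem_ofPred_eq] at ha hb
  rw [h3]
  generalize w (n - 1) = x at *
  generalize w n = y at *
  generalize w (n + 1) = z at *
  cases x <;> cases y <;> first
    | (simp [diagramZero] at ha; done)
    | cases z <;> first
      | exact absurd rfl hn
      | (simp [diagramZero] at hb; done)
      | simp only [exitSide, Fin.reduceAdd, c1, c2, c3, c4, derivedShift]
        ring

/-- The interval conditions at three consecutive positions confine `h n` to a subinterval, which κ -
h carries into that of the new side. Seven pairs of labels have to be checked. -/
theorem IsExchangeOrbit.of_isSandwiched {v : Plane} {w : Word} {h : ℤ → ℝ}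
    (H : IsExchangeOrbit v w h) (hv : InClosedSectorZero v) {n : ℤ}
    (hn : w (n - 1) = w (n + 1)) {m : Fin 8} (hm : m = sandwichSide (w n) (w (n - 1))) :
    cross (gamma *ᵥ v) (vertex (m + 1)) < derivedShift v (w (n - 1)) (w n) - h n ∧
    derivedShift v (w (n - 1)) (w n) - h n < cross (gamma *ᵥ v) (vertex m) ∧
    derivedShift v (w n) (w (n + 1)) - h (n + 1) =
      derivedShift v (w (n - 1)) (w n) - h n + cross (gamma *ᵥ v) (glue m) ∧
    w n = sideLabel m := by
  obtain ⟨h1, h2, h3⟩ := H n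
  obtain ⟨h4, h5, -⟩ := H (n + 1)
  obtain ⟨h6, h7, h8⟩ := H (n - 1)
  have ha := H.admissibleIn_zero hv (n - 1)
  obtain ⟨c0, c1, c2, c3, c4, -⟩ := cross_vertex v
  obtain ⟨d0, d1, d2, d3, d4, d5, d6, d7⟩ := cross_vertex (gamma *ᵥ v)
  obtain ⟨gx, gy⟩ := gamma_mulVec v
  have hg : √2 * (-v 0 + 2 * (v 1 + √2 * v 1)) = -(√2 * v 0) + 2 * (√2 * v 1 + 2 * v 1) := by
    linear_combination 2 * v 1 * sqrt_two_mul_self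
  simp only [gx, gy, hg] at d0 d1 d2 d3 d4 d5 d6 d7
  rw [sub_add_cancel] at ha h8
  simp only [diagram, relabel_zero, Set.mem_ofPred_eq] at ha
  rw [cross_glue, ← hn]
  rw [← hn] at h4 h5
  clear gx gy hg hv hn H
  generalize w (n - 1) = x at *
  generalize w n = y at *
  generalize h (n + 1) = k at *
  generalize h (n - 1) = l at *
  generalize h n = i at *
  subst hm
  cases x <;> cases y <;> first
    | (simp [diagramZero] at ha; done)
    | simp only [exitSide, Fin.reduceAdd, c0, c1, c2, c3, c4] at h1 h2 h3 h4 h5 h6 h7 h8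
      simp only [sandwichSide, derivedShift, Fin.reduceAdd, d0, d1, d2, d3, d4, d5, d6, d7]
      refine ⟨by linarith, by linarith, by linarith, rfl⟩

theorem IsExchangeOrbit.exists_derived {v : Plane} {w : Word} {h : ℤ → ℝ}
    (H : IsExchangeOrbit v w h) (hv : InClosedSectorZero v) :
    ∃ u, IsDerived w u ∧ IsTransversalCoding (gamma *ᵥ v) u := by
  have ha := H.admissibleIn_zero hv
  obtain ⟨φ, hφ, hr⟩ := exists_strictMono_range_eq (S := {n | IsSandwiched w n})
    (fun n => by
      obtain ⟨m, h1, -, h3⟩ := exists_isSandwiched_of_admissibleIn_zero ha n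
      exact ⟨m, h3, h1⟩)
    (fun n => by
      obtain ⟨m, -, h2, h3⟩ := exists_isSandwiched_of_admissibleIn_zero ha (n - 9)
      exact ⟨m, h3, by omega⟩)
  refine ⟨fun k => w (φ k), ⟨φ, hφ, hr, fun _ => rfl⟩, ?_⟩
  -- `h n` belongs to the segment that ends at letter `n`, hence the labels at `n - 1` and `n`.
  let K : ℤ → ℝ := fun n => derivedShift v (w (n - 1)) (w n) - h n
  have hK : ∀ n, n ∉ Set.range φ → K (n + 1) = K n := by
    intro n hn
    rw [hr, Set.mem_ofPred_eq, isSandwiched_iff] at hn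
    simpa only [K, add_sub_cancel_right] using H.derivedShift_eq hv hn
  refine ⟨fun k => K (φ k), fun k => sandwichSide (w (φ k)) (w (φ k - 1)), fun k => ?_⟩
  have hs : φ k ∈ {n | IsSandwiched w n} := hr ▸ Set.mem_range_self k
  obtain ⟨h1, h2, h3, h4⟩ := H.of_isSandwiched hv (isSandwiched_iff.1 hs) rfl
  refine ⟨h1, h2, ?_, h4⟩
  dsimp only
  rw [eq_of_const_off_range hφ hK k]
  simpa only [K, add_sub_cancel_right] using h3

/-- The group of sandwiched letters is determined by the sector of the derived trajectory. -/
theorem IsExchangeOrbit.mem_group {v : Plane} {w : Word} {h : ℤ → ℝ}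
    (H : IsExchangeOrbit v w h) (hv : InClosedSectorZero v) {j : Fin 8} (h0 : j ≠ 0)
    (hj : InClosedSectorZero (nu j *ᵥ (gamma *ᵥ v))) {k : Fin 4} (hk : (k : ℕ) = (j : ℕ) / 2)
    {n : ℤ} {L : Letter} (hL : IsSandwichedBy w n L) : (w n, L) ∈ group k := by
  obtain ⟨h1, h2, -, -⟩ := H.of_isSandwiched hv (hL.1.trans hL.2.symm) rfl
  have hlt := h1.trans h2
  have ha := H.admissibleIn_zero hv (n - 1)
  simp only [sub_add_cancel, diagram, relabel_zero, Set.mem_ofPred_eq] at ha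
  rw [hL.1] at hlt ha
  have hy : 0 ≤ (gamma *ᵥ v) 1 := by rw [(gamma_mulVec v).2]; exact hv.1
  clear h1 h2 hL
  generalize gamma *ᵥ v = v' at *
  generalize w n = y at *
  rw [nu_mulVec] at hj
  obtain ⟨d0, d1, d2, d3, d4, d5, d6, d7⟩ := cross_vertex v'
  have hr : 0 < √2 := by positivity
  have hry : 0 ≤ √2 * v' 1 := by positivity
  obtain ⟨hj1, hj2⟩ := hj
  -- Relaxing the bound π/8 to π/4 leaves the directions [kπ/4, (k+1)π/4] with k = [j/2], the same
  -- for j = 2k and j = 2k+1. These already decide the group.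
  have hj3 := (le_mul_of_one_le_left hj1 (by linarith : 1 ≤ 1 + √2)).trans hj2
  clear hj2
  have hpos : ∀ t : ℝ, 0 < √2 * t → 0 < t := fun t ht => pos_of_mul_pos_right ht hr.le
  have hpos' : ∀ t : ℝ, 0 < t → 0 < √2 * t := fun t ht => mul_pos hr ht
  -- Up to a positive factor, `s` is the component of γv along the outward normal of the crossed
  -- side. The D-sandwiched A lies in every group, so there `s` is immaterial.
  obtain ⟨s, hs, hs'⟩ : ∃ s : ℝ, (0 < s ∧ 0 < √2 * s) ∧
      ((y = A ∧ L = D) ∨ (y = B ∧ L = C ∧ s = v' 0 + v' 1) ∨ (y = B ∧ L = D ∧ s = -v' 0 - v' 1) ∨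
      (y = C ∧ L = B ∧ s = v' 0) ∨ (y = C ∧ L = C ∧ s = -v' 0) ∨
      (y = D ∧ L = A ∧ s = v' 0 - v' 1) ∨ (y = D ∧ L = B ∧ s = v' 1 - v' 0)) := by
    cases L <;> cases y <;> first
      | (simp [diagramZero] at ha; done)
      | simp only [sandwichSide, Fin.reduceAdd, d0, d1, d2, d3, d4, d5, d6, d7] at hlt
        simp only [reduceCtorEq, false_and, and_false, false_or, or_false, true_and, and_true,
          exists_eq_right]
        first
          | exact ⟨1, one_pos, by linarith⟩
          | exact ⟨by linarith, hpos' _ (by linarith)⟩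
          | exact ⟨hpos _ (by linarith), by linarith⟩
  have key : k = ![0, 0, 1, 1, 2, 2, 3, 3] j := by
    revert hk
    clear * -
    revert j k
    decide
  subst key
  clear hlt d0 d1 d2 d3 d4 d5 d6 d7 H hv hk ha
  fin_cases j
  · exact absurd rfl h0
  all_goals
    change 0 ≤ (_ : ℝ) at hj1
    change (_ : ℝ) ≤ _ at hj3
    simp at hj1 hj3
    rcases hs' with ⟨rfl, rfl⟩ | ⟨rfl, rfl, rfl⟩ | ⟨rfl, rfl, rfl⟩ | ⟨rfl, rfl, rfl⟩ |
      ⟨rfl, rfl, rfl⟩ | ⟨rfl, rfl, rfl⟩ | ⟨rfl, rfl, rfl⟩ <;> first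
      | (simp [group]; done)
      | (exfalso; linarith)

/-! ### The renormalization step and its iteration -/

theorem IsTransversalCoding.velocity_ne_zero {v : Plane} {w : Word}
    (hw : IsTransversalCoding v w) : v ≠ 0 := by
  rintro rfl
  obtain ⟨h, e, H⟩ := hw
  obtain ⟨h1, h2, -⟩ := H 0
  simp only [cross, Pi.zero_apply, zero_mul, sub_zero] at h1 h2
  exact h1.not_gt h2

/-- The renormalization step: a coding of a trajectory is coherent with respect to the sectors of
the trajectory and of the next renormalized trajectory. -/
theorem IsTransversalCoding.renormalize {τ : Trajectory} {w : Word}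
    (hw : IsTransversalCoding τ.velocity w) (hτ : 0 ≤ τ.velocity 1) :
    ∃ u, IsDerived (Octagon.act τ.sector w) u ∧
      IsTransversalCoding τ.normalForm.derived.velocity u ∧
      0 ≤ τ.normalForm.derived.velocity 1 ∧
      τ.normalForm.derived.sector ≠ 0 ∧
      CoherentWith w τ.sector τ.normalForm.derived.sector := by
  have hv := inClosedSectorZero_nu_sector τ hτ
  obtain ⟨h, H⟩ := (hw.act τ.sector).exists_isExchangeOrbit hv
  obtain ⟨u, hd, hu⟩ := H.exists_derived hv
  obtain ⟨gx, gy⟩ := gamma_mulVec (nu τ.sector *ᵥ τ.velocity)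
  have hu' : IsTransversalCoding τ.normalForm.derived.velocity u := hu
  have hτ' : 0 ≤ τ.normalForm.derived.velocity 1 := hv.1.trans_eq gy.symm
  have hv' := inClosedSectorZero_nu_sector _ hτ'
  have hj : τ.normalForm.derived.sector ≠ 0 := by
    refine sector_ne_zero hτ' hu'.velocity_ne_zero ?_
    change (gamma *ᵥ (nu τ.sector *ᵥ τ.velocity)) 0 ≤
      (1 + √2) * (gamma *ᵥ (nu τ.sector *ᵥ τ.velocity)) 1
    rw [gx, gy]
    linarith [hv.2]
  have ha : AdmissibleIn τ.sector w := admissibleIn_iff.2 (H.admissibleIn_zero hv)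
  have ha' : AdmissibleIn τ.normalForm.derived.sector u := by
    obtain ⟨h', H'⟩ := (hu'.act _).exists_isExchangeOrbit hv'
    exact admissibleIn_iff.2 (H'.admissibleIn_zero hv')
  exact ⟨u, hd, hu', hτ', hj, derivable_of_act ⟨_, ha⟩ hd ⟨_, ha'⟩, ha,
    ⟨(τ.normalForm.derived.sector : ℕ) / 2, by omega⟩,
    fun n L hL => H.mem_group hv hj hv' rfl hL, ⟨hj, u, hd, ha'⟩, rfl⟩

theorem Trajectory.upward_velocity_nonneg (τ : Trajectory) : 0 ≤ τ.upward.velocity 1 := by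
  unfold Trajectory.upward
  split_ifs with h
  · exact h
  · exact neg_nonneg.2 (not_le.1 h).le

theorem IsTransversalCoding.upward {τ : Trajectory} {w : Word}
    (hw : IsTransversalCoding τ.velocity w) : IsTransversalCoding τ.upward.velocity w := by
  unfold Trajectory.upward
  split_ifs
  · exact hw
  · exact hw.neg

theorem IsCuttingSequence.infinitelyCoherentWith {τ : Trajectory} {w : Word}
    (hw : IsCuttingSequence τ w) : InfinitelyCoherentWith w τ.sectors := by
  -- The recursion carries the invariant that the `k`-th word codes the direction of τ_k, which
  -- points upwards or horizontally.
  let R : ℕ → Type := fun k => {u : Word //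
    IsTransversalCoding (τ.renormalized k).velocity u ∧ 0 ≤ (τ.renormalized k).velocity 1}
  choose f hd hc hn hs hco using fun (k : ℕ) (u : R k) => u.2.1.renormalize u.2.2
  let S : (k : ℕ) → R k := fun k => Nat.rec
    ⟨w, hw.isTransversalCoding.upward, τ.upward_velocity_nonneg⟩
    (fun k u => ⟨f k u, hc k u, hn k u⟩) k
  have hW : IsRenormalizedSequence w τ.sectors (fun k => (S k).1) :=
    ⟨rfl, fun k => hd k (S k)⟩
  have hcoh : ∀ k, CoherentWith (S k).1 (τ.sectors k) (τ.sectors (k + 1)) := fun k => hco k (S k)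
  refine ⟨fun k hk => ?_, infinitelyDerivable_of_renormalized hW fun k => (hcoh k).1.1, _, hW, hcoh⟩
  cases k with
  | zero => rfl
  | succ k => exact absurd hk (hs k (S k))

end

end Octagon

theorem proposition2p10 (τ : Octagon.Trajectory) (w : Octagon.Word)
    (hw : Octagon.IsCuttingSequence τ w) :
    Octagon.InfinitelyCoherentWith w τ.sectors :=
  hw.infinitelyCoherentWith
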